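/- Let $X$ be a complex Banach space and let $T\colon X\to X$ be a Ritt operator, that is, a bounded linear operator for which there are constants $c_0,c_1\ge 0$ with $\|T^k\|\le c_0$ for all $k\ge 0$ and $k\,\|T^k-T^{k-1}\|\le c_1$ for all $k\ge 1$. Let $\alpha,\beta>-1$ be real numbers such that $m=\frac{\alpha+\beta}{2}$ is a nonnegative integer. For a bounded sectorial operator $B$ on $X$ and $a>0$, let $B^a$ denote the fractional power $$B^a=\frac{\Gamma(n)}{\Gamma(a)\Gamma(n-a)}\int_0^\infty t^{a-1}\bigl(B(t+B)^{-1}\bigr)^n\,dt,\qquad n=\lfloor a\rfloor+1 .$$ Then $t+(I-T)$ is invertible for every $t>0$ and the integral defining $(I-T)^{\frac{1+\alpha}{2}}$ converges absolutely in operator norm; for every $\omega\in\mathbb{C}$ with $|\omega|<1$ the operator $I-\omega T$ is invertible; and there exists a constant $K\ge 0$ such that $$\bigl(1-|\omega|^2\bigr)^{\frac{1+\beta}{2}}\,\bigl\|(I-T)^{\frac{1+\alpha}{2}}(I-\omega T)^{-(m+1)}\bigr\|\le K,\qquad \omega\in\mathbb{C},\ |\omega|<1 .$$ -/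

import Mathlib

/-- `T` is power bounded: there is `c₀ ≥ 0` with `‖T ^ k‖ ≤ c₀` for every `k ≥ 0`. -/
def IsPowerBounded {X : Type*} [NormedAddCommGroup X] [NormedSpace ℂ X]
    (T : X →L[ℂ] X) : Prop :=
  ∃ c₀ : ℝ, 0 ≤ c₀ ∧ ∀ k : ℕ, ‖T ^ k‖ ≤ c₀

/-- `T` is a Ritt operator: it is power bounded and there is `c₁ ≥ 0` with
`k * ‖T ^ k - T ^ (k - 1)‖ ≤ c₁` for every `k ≥ 1`. -/
def IsRittOperator {X : Type*} [NormedAddCommGroup X] [NormedSpace ℂ X]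
    (T : X →L[ℂ] X) : Prop :=
  IsPowerBounded T ∧
    ∃ c₁ : ℝ, 0 ≤ c₁ ∧ ∀ k : ℕ, 1 ≤ k → (k : ℝ) * ‖T ^ k - T ^ (k - 1)‖ ≤ c₁

/-- The integrand `t ^ (a - 1) (B (t + B)⁻¹) ^ n`, with `n = ⌊a⌋ + 1`, of the Balakrishnan integral
for `B ^ a`. `Ring.inverse` is the inverse in the algebra of bounded operators. -/
noncomputable def fracPowIntegrand {X : Type*} [NormedAddCommGroup X] [NormedSpace ℂ X]
    (B : X →L[ℂ] X) (a : ℝ) (t : ℝ) : X →L[ℂ] X :=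
  ((t ^ (a - 1) : ℝ) : ℂ) •
    (B * Ring.inverse ((t : ℂ) • (1 : X →L[ℂ] X) + B)) ^ (⌊a⌋₊ + 1)

/-- The fractional power `B ^ a`, `a > 0`, of a bounded sectorial operator `B`
(Balakrishnan's definition): with `n = ⌊a⌋ + 1 > a`,
`B ^ a = Γ(n) / (Γ(a) Γ(n - a)) * ∫_0^∞ t ^ (a - 1) (B (t + B)⁻¹) ^ n dt`,
a Bochner integral in the Banach space of bounded operators. For a scalar `B = b > 0` this is the
Beta integral for the usual power `b ^ a`. -/
noncomputable def fracPow {X : Type*} [NormedAddCommGroup X] [NormedSpace ℂ X]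
    (B : X →L[ℂ] X) (a : ℝ) : X →L[ℂ] X :=
  ((Real.Gamma ((⌊a⌋₊ : ℝ) + 1) /
      (Real.Gamma a * Real.Gamma ((⌊a⌋₊ : ℝ) + 1 - a)) : ℝ) : ℂ) •
    ∫ t in Set.Ioi (0 : ℝ), fracPowIntegrand B a t

/-!
Put `A = 1 - T`, `a = (1 + α) / 2`, `b = (1 + β) / 2`, so that `a + b = m + 1`. Everything rests on
the decay `‖A ^ a T ^ k‖ = O((k + 1) ^ (-a))` of `IsRittOperator.exists_norm_fracPow_mul_pow_le`.
Granted this, expand `(1 - ω T) ^ (-(m + 1)) = ∑ C(k + m, m) ω ^ k T ^ k`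
(`hasSum_choose_nsmul_pow`). As `C(k + m, m) ≤ (k + 1) ^ m`, the norm of
`A ^ a (1 - ω T) ^ (-(m + 1))` is at most a constant times
`∑ (k + 1) ^ (m - a) |ω| ^ k = ∑ (k + 1) ^ (b - 1) |ω| ^ k`, which is `O((1 - |ω|) ^ (-b))` because
`b > 0` (`exists_tsum_rpow_mul_pow_le`).

For the decay, let `n = ⌊a⌋ + 1`. Power boundedness gives `‖(t + A)⁻¹‖ = O(1 / t)` for `t > 0` by a
Neumann series, and the Ritt condition gives `‖A ^ n T ^ k‖ = O((k + 1) ^ (-n))` by splitting `T ^ k`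
into `n` nearly equal powers. Hence `‖(A (t + A)⁻¹) ^ n T ^ k‖ = O(min 1 (((k + 1) t) ^ (-n)))`.
Since `0 < a < n`, integrating this against `t ^ (a - 1)` converges, and the substitution
`t ↦ t / (k + 1)` produces the factor `(k + 1) ^ (-a)`. In particular the resolvent estimate
`‖(1 - ω T)⁻¹‖ = O(1 / |1 - ω|)` is not needed.
-/

/-! ### Weighted geometric series -/

theorem rpow_le_const_mul_exp_half {c x : ℝ} (hc : 0 ≤ c) (hx : 0 ≤ x) :
    x ^ c ≤ (2 * c) ^ c * Real.exp (x / 2) := by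
  rcases hc.eq_or_lt with rfl | hc
  · simpa using div_nonneg hx zero_le_two
  · have hy : 0 ≤ x / (2 * c) := by positivity
    calc x ^ c = (2 * c * (x / (2 * c))) ^ c := by congr 1; field_simp
      _ = (2 * c) ^ c * (x / (2 * c)) ^ c := Real.mul_rpow (by positivity) hy
      _ ≤ (2 * c) ^ c * Real.exp (x / (2 * c)) ^ c := by
          gcongr
          linarith [Real.add_one_le_exp (x / (2 * c))]
      _ = (2 * c) ^ c * Real.exp (x / 2) := by
          rw [← Real.exp_mul]; congr 2; field_simp

/-- With `δ = 1 - r`, the weight `((k + 1) δ) ^ c` is absorbed by half of the exponential decay of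
`r ^ k`, which leaves a geometric series of ratio `1 - δ / 2`. -/
theorem rpow_mul_pow_le {c r : ℝ} (hc : 0 ≤ c) (hr0 : 0 ≤ r) (hr1 : r < 1) (k : ℕ) :
    (1 - r) ^ c * (((k : ℝ) + 1) ^ c * r ^ k) ≤
      (2 * c) ^ c * Real.exp (1 / 2) * (1 - (1 - r) / 2) ^ k := by
  have hδ : 0 < 1 - r := by linarith
  -- from `exp (δ / 2) ≤ 1 / (1 - δ / 2)` and `1 - δ ≤ (1 - δ / 2) ^ 2`, where `δ = 1 - r`
  have key : r * Real.exp ((1 - r) / 2) ≤ 1 - (1 - r) / 2 := by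
    have h1 : (1 - (1 - r) / 2) * Real.exp ((1 - r) / 2) ≤ 1 := by
      have := Real.one_sub_le_exp_neg ((1 - r) / 2)
      calc _ ≤ Real.exp (-((1 - r) / 2)) * Real.exp ((1 - r) / 2) := by gcongr
        _ = 1 := by rw [← Real.exp_add]; simp
    calc r * Real.exp ((1 - r) / 2)
        ≤ (1 - (1 - r) / 2) ^ 2 * Real.exp ((1 - r) / 2) := by
          gcongr; nlinarith [sq_nonneg (1 - r)]
      _ = (1 - (1 - r) / 2) * ((1 - (1 - r) / 2) * Real.exp ((1 - r) / 2)) := by ring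
      _ ≤ (1 - (1 - r) / 2) * 1 := by gcongr; linarith
      _ = _ := mul_one _
  calc (1 - r) ^ c * (((k : ℝ) + 1) ^ c * r ^ k)
      = ((1 - r) * ((k : ℝ) + 1)) ^ c * r ^ k := by
        rw [Real.mul_rpow hδ.le (by positivity)]; ring
    _ ≤ (2 * c) ^ c * Real.exp ((1 - r) * ((k : ℝ) + 1) / 2) * r ^ k := by
        gcongr; exact rpow_le_const_mul_exp_half hc (by positivity)
    _ = (2 * c) ^ c * Real.exp ((1 - r) / 2) * (r * Real.exp ((1 - r) / 2)) ^ k := by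
        rw [mul_pow, ← Real.exp_nat_mul,
          show (1 - r) * ((k : ℝ) + 1) / 2 = (1 - r) / 2 + k * ((1 - r) / 2) by ring, Real.exp_add]
        ring
    _ ≤ (2 * c) ^ c * Real.exp (1 / 2) * (1 - (1 - r) / 2) ^ k := by
        gcongr; linarith

theorem exists_tsum_rpow_mul_pow_le_of_nonneg {c : ℝ} (hc : 0 ≤ c) :
    ∃ C : ℝ, 0 ≤ C ∧ ∀ r : ℝ, 0 ≤ r → r < 1 →
      Summable (fun k : ℕ => ((k : ℝ) + 1) ^ c * r ^ k) ∧
      (1 - r) ^ (c + 1) * ∑' k : ℕ, ((k : ℝ) + 1) ^ c * r ^ k ≤ C := by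
  refine ⟨(2 * c) ^ c * Real.exp (1 / 2) * 2, by positivity, fun r hr0 hr1 => ?_⟩
  have hδ : 0 < 1 - r := by linarith
  have hg := (hasSum_geometric_of_lt_one (r := 1 - (1 - r) / 2) (by linarith) (by linarith)).mul_left
    ((2 * c) ^ c * Real.exp (1 / 2))
  have hs : Summable (fun k : ℕ => (1 - r) ^ c * (((k : ℝ) + 1) ^ c * r ^ k)) :=
    hg.summable.of_nonneg_of_le (fun k => by positivity) (rpow_mul_pow_le hc hr0 hr1)
  have hδc : (1 - r) ^ c ≠ 0 := by positivity
  refine ⟨(summable_mul_left_iff hδc).1 hs, ?_⟩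
  have h := hs.tsum_le_tsum (rpow_mul_pow_le hc hr0 hr1) hg.summable
  rw [hg.tsum_eq, tsum_mul_left, show 1 - (1 - (1 - r) / 2) = (1 - r) / 2 by ring] at h
  rw [Real.rpow_add hδ, Real.rpow_one, mul_comm _ (1 - r), mul_assoc]
  calc _ ≤ (1 - r) * ((2 * c) ^ c * Real.exp (1 / 2) * ((1 - r) / 2)⁻¹) := by gcongr
    _ = _ := by field_simp

/-- Concavity of `x ↦ x ^ b`: its derivative at `k + 1` is at most its increment over `[k, k + 1]`. -/
theorem rpow_sub_one_le_sub {b : ℝ} (hb0 : 0 < b) (hb1 : b ≤ 1) (k : ℕ) :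
    ((k : ℝ) + 1) ^ (b - 1) ≤ b⁻¹ * (((k : ℝ) + 1) ^ b - (k : ℝ) ^ b) := by
  have hk : (0 : ℝ) < (k : ℝ) + 1 := by positivity
  have hk' : ((k : ℝ) + 1)⁻¹ ≤ 1 := inv_le_one_of_one_le₀ (by linarith [k.cast_nonneg (α := ℝ)])
  have h := rpow_one_add_le_one_add_mul_self (s := -((k : ℝ) + 1)⁻¹) (by linarith) hb0.le hb1
  have h2 : (k : ℝ) ^ b = ((k : ℝ) + 1) ^ b * (1 + -((k : ℝ) + 1)⁻¹) ^ b := by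
    rw [← Real.mul_rpow hk.le (by linarith)]
    congr 1; field_simp; ring
  rw [← mul_le_mul_iff_right₀ hb0, mul_inv_cancel_left₀ hb0.ne', h2, Real.rpow_sub_one hk.ne']
  have := mul_le_mul_of_nonneg_left h (Real.rpow_nonneg hk.le b)
  rw [div_eq_mul_inv]
  linarith

/-- `∑ (k + 1) ^ (b - 1) r ^ k = O((1 - r) ^ (-b))`. For `b < 1` the weight decreases; it is
dominated by the increments of `k ^ b`, and summation by parts turns these into the weight
`(k + 1) ^ b` at the price of a factor `1 - r`. -/
theorem exists_tsum_rpow_mul_pow_le {b : ℝ} (hb : 0 < b) :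
    ∃ C : ℝ, 0 ≤ C ∧ ∀ r : ℝ, 0 ≤ r → r < 1 →
      Summable (fun k : ℕ => ((k : ℝ) + 1) ^ (b - 1) * r ^ k) ∧
      (1 - r) ^ b * ∑' k : ℕ, ((k : ℝ) + 1) ^ (b - 1) * r ^ k ≤ C := by
  rcases le_total 1 b with h1 | h1
  · simpa using exists_tsum_rpow_mul_pow_le_of_nonneg (c := b - 1) (by linarith)
  · obtain ⟨C, hC0, hC⟩ := exists_tsum_rpow_mul_pow_le_of_nonneg hb.le
    refine ⟨b⁻¹ * C, by positivity, fun r hr0 hr1 => ?_⟩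
    obtain ⟨hs, hle⟩ := hC r hr0 hr1
    have hδ : 0 < 1 - r := by linarith
    -- the shifted series, whose zeroth term vanishes because `0 ^ b = 0`
    have hshift : HasSum (fun k : ℕ => (k : ℝ) ^ b * r ^ k)
        (r * ∑' k : ℕ, ((k : ℝ) + 1) ^ b * r ^ k) := by
      have := hs.hasSum.mul_left r
      refine (hasSum_nat_add_iff' 1).1 ?_
      convert! this using 1
      · ext k; push_cast; ring
      · simp [Real.zero_rpow hb.ne']
    have hd := (hs.hasSum.sub hshift).mul_left b⁻¹
    have hterm : ∀ k : ℕ, ((k : ℝ) + 1) ^ (b - 1) * r ^ k ≤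
        b⁻¹ * (((k : ℝ) + 1) ^ b * r ^ k - (k : ℝ) ^ b * r ^ k) := fun k => by
      calc _ ≤ (b⁻¹ * (((k : ℝ) + 1) ^ b - (k : ℝ) ^ b)) * r ^ k := by
            gcongr; exact rpow_sub_one_le_sub hb h1 k
        _ = _ := by ring
    have hs' : Summable (fun k : ℕ => ((k : ℝ) + 1) ^ (b - 1) * r ^ k) :=
      hd.summable.of_nonneg_of_le (fun k => by positivity) hterm
    refine ⟨hs', ?_⟩
    calc _ ≤ (1 - r) ^ b * (b⁻¹ * (∑' k : ℕ, ((k : ℝ) + 1) ^ b * r ^ k -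
            r * ∑' k : ℕ, ((k : ℝ) + 1) ^ b * r ^ k)) := by
          gcongr; exact (hs'.tsum_le_tsum hterm hd.summable).trans_eq hd.tsum_eq
      _ = b⁻¹ * ((1 - r) ^ (b + 1) * ∑' k : ℕ, ((k : ℝ) + 1) ^ b * r ^ k) := by
          rw [Real.rpow_add hδ, Real.rpow_one]; ring
      _ ≤ b⁻¹ * C := by gcongr

/-! ### Neumann series and powers of resolvents -/

/-- The binomial series of `(1 - x) ^ (-(m + 1))` under geometric decay of the powers of `x`. Unlike
in `hasSum_choose_mul_geometric_of_norm_lt_one`, the norm of `x` itself may exceed `1`, as it does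
for `ω • T` with `T` merely power bounded. -/
theorem hasSum_choose_nsmul_pow {𝔸 : Type*} [NormedRing 𝔸] [CompleteSpace 𝔸] {x : 𝔸} {c r : ℝ}
    (hr0 : 0 ≤ r) (hr1 : r < 1) (hx : ∀ k : ℕ, ‖x ^ k‖ ≤ c * r ^ k) :
    IsUnit (1 - x) ∧
      ∀ m : ℕ, HasSum (fun k : ℕ => (k + m).choose m • x ^ k) (Ring.inverse (1 - x) ^ (m + 1)) := by
  have hsum : ∀ m : ℕ, Summable (fun k : ℕ => (k + m).choose m • x ^ k) := fun m => by
    have hr : ‖r‖ < 1 := by rwa [Real.norm_of_nonneg hr0]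
    refine ((summable_choose_mul_geometric_of_norm_lt_one m hr).mul_left c).of_norm_bounded
      fun k => ?_
    calc _ ≤ ((k + m).choose m : ℝ) * ‖x ^ k‖ := norm_nsmul_le
      _ ≤ ((k + m).choose m : ℝ) * (c * r ^ k) := by gcongr; exact hx k
      _ = _ := by ring
  have hs0 : Summable (fun k : ℕ => x ^ k) := by simpa using hsum 0
  have hu : IsUnit (1 - x) :=
    ⟨⟨1 - x, ∑' k, x ^ k, hs0.one_sub_mul_tsum_pow, hs0.tsum_pow_mul_one_sub⟩, rfl⟩
  refine ⟨hu, fun m => ?_⟩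
  induction m with
  | zero =>
    have : Ring.inverse (1 - x) = ∑' k, x ^ k := by
      have := (Ring.eq_mul_inverse_iff_mul_eq (∑' k, x ^ k) 1 _ hu).2 hs0.tsum_pow_mul_one_sub
      simpa using this.symm
    simpa [this] using hs0.hasSum
  | succ m ih =>
    have hS := (hsum (m + 1)).hasSum
    -- Pascal's rule: multiplying the series of order `m + 1` by `1 - x` gives that of order `m`
    have hshift : HasSum (fun k : ℕ => (k + m).choose (m + 1) • x ^ k)
        ((∑' k : ℕ, (k + (m + 1)).choose (m + 1) • x ^ k) * x) := by
      refine (hasSum_nat_add_iff' 1).1 ?_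
      convert! hS.mul_right x using 1
      · ext k
        rw [smul_mul_assoc, ← pow_succ]
        congr 2; ring
      · simp
    have hdiff := hS.sub hshift
    have heq : (fun k : ℕ => (k + m).choose m • x ^ k) = fun k : ℕ =>
        (k + (m + 1)).choose (m + 1) • x ^ k - (k + m).choose (m + 1) • x ^ k := by
      ext k
      rw [← add_assoc, Nat.choose_succ_succ, add_smul, add_sub_cancel_right]
    rw [← heq] at hdiff
    have := hdiff.unique ih
    rw [pow_succ, ← this, show ∀ S : 𝔸, S - S * x = S * (1 - x) from fun S => by noncomm_ring,
      Ring.mul_inverse_cancel_right _ _ hu]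
    exact hS

/-! ### Resolvent and power estimates for Ritt operators -/

section Ritt

variable {X : Type*} [NormedAddCommGroup X] [NormedSpace ℂ X]

theorem norm_smul_pow_le {T : X →L[ℂ] X} {c : ℝ} (hT : ∀ k : ℕ, ‖T ^ k‖ ≤ c) (ω : ℂ) (k : ℕ) :
    ‖(ω • T) ^ k‖ ≤ c * ‖ω‖ ^ k := by
  rw [smul_pow, norm_smul, norm_pow, mul_comm]
  gcongr
  exact hT k

theorem norm_inverse_one_sub_smul_le [CompleteSpace X] {T : X →L[ℂ] X} {c : ℝ}
    (hT : ∀ k : ℕ, ‖T ^ k‖ ≤ c) {ω : ℂ} (hω : ‖ω‖ < 1) :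
    ‖Ring.inverse (1 - ω • T)‖ ≤ c * (1 - ‖ω‖)⁻¹ := by
  have h := (hasSum_choose_nsmul_pow (norm_nonneg ω) hω (norm_smul_pow_le hT ω)).2 0
  simp only [add_zero, Nat.choose_zero_right, one_smul, zero_add, pow_one] at h
  rw [← h.tsum_eq]
  exact tsum_of_norm_bounded ((hasSum_geometric_of_lt_one (norm_nonneg ω) hω).mul_left c)
    (norm_smul_pow_le hT ω)

/-- Sectoriality of `1 - T` on the positive half-line: since `t + (1 - T) = (1 + t) - T`, its
inverse is a Neumann series. -/
theorem isUnit_smul_one_add_one_sub [CompleteSpace X] {T : X →L[ℂ] X} {c : ℝ}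
    (hT : ∀ k : ℕ, ‖T ^ k‖ ≤ c) {t : ℝ} (ht : 0 < t) :
    IsUnit ((t : ℂ) • (1 : X →L[ℂ] X) + (1 - T)) ∧
      t * ‖Ring.inverse ((t : ℂ) • (1 : X →L[ℂ] X) + (1 - T))‖ ≤ c := by
  set ω : ℂ := ((1 + t : ℝ) : ℂ)⁻¹ with hω
  have ht1 : ((1 + t : ℝ) : ℂ) ≠ 0 := by exact_mod_cast (by positivity : (1 + t : ℝ) ≠ 0)
  have hωn : ‖ω‖ = (1 + t)⁻¹ := by
    rw [hω, norm_inv, Complex.norm_of_nonneg (by positivity)]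
  have hω1 : ‖ω‖ < 1 := by rw [hωn]; exact inv_lt_one_of_one_lt₀ (by linarith)
  have hu := (hasSum_choose_nsmul_pow (norm_nonneg ω) hω1 (norm_smul_pow_le hT ω)).1
  have hfac : (t : ℂ) • (1 : X →L[ℂ] X) + (1 - T) = ((1 + t : ℝ) : ℂ) • (1 - ω • T) := by
    rw [smul_sub, smul_smul, hω, mul_inv_cancel₀ ht1, one_smul]
    push_cast
    rw [add_smul, one_smul]
    abel
  let u : (X →L[ℂ] X)ˣ := ⟨((1 + t : ℝ) : ℂ) • (1 - ω • T), ω • Ring.inverse (1 - ω • T),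
    by rw [smul_mul_smul_comm, Ring.mul_inverse_cancel _ hu, hω, mul_inv_cancel₀ ht1, one_smul],
    by rw [smul_mul_smul_comm, Ring.inverse_mul_cancel _ hu, hω, inv_mul_cancel₀ ht1, one_smul]⟩
  have hinv : Ring.inverse ((t : ℂ) • (1 : X →L[ℂ] X) + (1 - T)) = ω • Ring.inverse (1 - ω • T) := by
    rw [hfac]; exact Ring.inverse_unit u
  refine ⟨hfac ▸ u.isUnit, ?_⟩
  rw [hinv, norm_smul]
  calc t * (‖ω‖ * ‖Ring.inverse (1 - ω • T)‖) ≤ t * (‖ω‖ * (c * (1 - ‖ω‖)⁻¹)) := by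
        gcongr; exact norm_inverse_one_sub_smul_le hT hω1
    _ = c := by
        rw [hωn, show 1 - (1 + t)⁻¹ = t / (1 + t) by field_simp; ring]
        field_simp

/-- Writing `k = n q + r`, one has `T ^ k (1 - T) ^ n = (T ^ q (1 - T)) ^ n T ^ r`, and each of the
`n` factors is `O(1 / (q + 1)) = O(1 / (k + 1))`. -/
theorem IsRittOperator.exists_norm_pow_mul_one_sub_pow_le {T : X →L[ℂ] X} (hT : IsRittOperator T)
    {n : ℕ} (hn : 0 < n) :
    ∃ M : ℝ, 0 ≤ M ∧ ∀ k : ℕ, ((k : ℝ) + 1) ^ n * ‖(1 - T) ^ n * T ^ k‖ ≤ M := by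
  obtain ⟨⟨c₀, hc₀, hT₀⟩, c₁, hc₁, hT₁⟩ := hT
  refine ⟨(n * c₁) ^ n * c₀, by positivity, fun k => ?_⟩
  have h1 : ∀ q : ℕ, ((q : ℝ) + 1) * ‖T ^ q * (1 - T)‖ ≤ c₁ := fun q => by
    have := hT₁ (q + 1) (by omega)
    rw [add_tsub_cancel_right, norm_sub_rev] at this
    rw [mul_sub, mul_one, ← pow_succ]
    exact_mod_cast this
  have hcomm : ∀ q : ℕ, Commute (T ^ q) (1 - T) := fun q =>
    ((Commute.one_right T).sub_right (Commute.refl T)).pow_left q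
  have hfac : (1 - T) ^ n * T ^ k = (T ^ (k / n) * (1 - T)) ^ n * T ^ (k % n) := by
    rw [(hcomm _).mul_pow, ((hcomm (k / n)).pow_pow n n).eq, mul_assoc, ← pow_mul, ← pow_add,
      mul_comm (k / n) n, Nat.div_add_mod]
  have hk : (k : ℝ) + 1 ≤ n * ((k / n : ℕ) + 1) := by
    have := Nat.lt_mul_div_succ k hn
    exact_mod_cast this
  calc ((k : ℝ) + 1) ^ n * ‖(1 - T) ^ n * T ^ k‖
      ≤ (n * ((k / n : ℕ) + 1)) ^ n * (‖T ^ (k / n) * (1 - T)‖ ^ n * c₀) := by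
        rw [hfac]
        gcongr
        refine (norm_mul_le _ _).trans ?_
        gcongr
        · exact norm_pow_le' _ hn
        · exact hT₀ _
    _ = (n * (((k / n : ℕ) + 1) * ‖T ^ (k / n) * (1 - T)‖)) ^ n * c₀ := by
        rw [← mul_assoc, ← mul_pow, mul_assoc (n : ℝ)]
    _ ≤ (n * c₁) ^ n * c₀ := by gcongr; exact h1 _

/-- The bound by a constant is sectoriality together with power boundedness; the bound by
`((k + 1) t) ^ (-n)` pairs `‖(t + A)⁻¹‖ = O(1 / t)` with the decay of `A ^ n T ^ k`, where
`A = 1 - T`. -/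
theorem IsRittOperator.exists_norm_resolvent_pow_mul_pow_le [CompleteSpace X] {T : X →L[ℂ] X}
    (hT : IsRittOperator T) {n : ℕ} (hn : 0 < n) :
    ∃ M : ℝ, 0 ≤ M ∧ ∀ (k : ℕ) (t : ℝ), 0 < t →
      ‖((1 - T) * Ring.inverse ((t : ℂ) • (1 : X →L[ℂ] X) + (1 - T))) ^ n * T ^ k‖ ≤
        M * min 1 (((k + 1) * t) ^ n)⁻¹ := by
  obtain ⟨M, hM0, hM⟩ := hT.exists_norm_pow_mul_one_sub_pow_le hn
  obtain ⟨⟨c, hc, hT₀⟩, -⟩ := hT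
  refine ⟨max ((2 * c) ^ n * c) (c ^ n * M), by positivity, fun k t ht => ?_⟩
  obtain ⟨hu, hR⟩ := isUnit_smul_one_add_one_sub hT₀ ht
  set R := Ring.inverse ((t : ℂ) • (1 : X →L[ℂ] X) + (1 - T)) with hRdef
  have hAR : (1 - T) * R = 1 - (t : ℂ) • R := by
    have := Ring.mul_inverse_cancel _ hu
    rw [← hRdef, add_mul, smul_one_mul] at this
    exact eq_sub_of_add_eq' this
  have hRA : R * (1 - T) = 1 - (t : ℂ) • R := by
    have := Ring.inverse_mul_cancel _ hu
    rw [← hRdef, mul_add, mul_smul_one] at this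
    exact eq_sub_of_add_eq' this
  have hcomm : Commute (1 - T) R := hAR.trans hRA.symm
  rw [mul_min_of_nonneg _ _ (by positivity), le_min_iff]
  constructor
  · have hARn : ‖(1 - T) * R‖ ≤ 2 * c := by
      rw [hAR]
      refine (norm_sub_le _ _).trans ?_
      have h1 : ‖(1 : X →L[ℂ] X)‖ ≤ c := by simpa using hT₀ 0
      rw [norm_smul, Complex.norm_of_nonneg ht.le]
      linarith
    calc ‖((1 - T) * R) ^ n * T ^ k‖ ≤ (2 * c) ^ n * c := by
          refine (norm_mul_le _ _).trans ?_
          gcongr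
          · exact (norm_pow_le' _ hn).trans (by gcongr)
          · exact hT₀ k
      _ ≤ _ := by rw [mul_one]; exact le_max_left _ _
  · rw [← div_eq_mul_inv, le_div_iff₀ (by positivity)]
    calc ‖((1 - T) * R) ^ n * T ^ k‖ * ((k + 1) * t) ^ n
        = ‖R ^ n * ((1 - T) ^ n * T ^ k)‖ * ((k + 1) * t) ^ n := by
          rw [hcomm.mul_pow, (hcomm.pow_pow n n).eq, mul_assoc]
      _ ≤ (‖R‖ ^ n * ‖(1 - T) ^ n * T ^ k‖) * ((k + 1) * t) ^ n := by
          gcongr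
          refine (norm_mul_le _ _).trans ?_
          gcongr
          exact norm_pow_le' _ hn
      _ = (t * ‖R‖) ^ n * (((k : ℝ) + 1) ^ n * ‖(1 - T) ^ n * T ^ k‖) := by
          rw [mul_pow, mul_pow]; ring
      _ ≤ c ^ n * M := by gcongr; exact hM k
      _ ≤ _ := le_max_right _ _

end Ritt

/-! ### Decay of `(1 - T) ^ a T ^ k` -/

theorem integrableOn_rpow_mul_min {a : ℝ} {n : ℕ} (ha : 0 < a) (han : a < n) :
    MeasureTheory.IntegrableOn (fun t : ℝ => t ^ (a - 1) * min 1 (t ^ n)⁻¹) (Set.Ioi 0) := by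
  have hmeas : Measurable fun t : ℝ => t ^ (a - 1) * min 1 (t ^ n)⁻¹ := by fun_prop
  rw [← Set.Ioc_union_Ioi_eq_Ioi zero_le_one]
  refine MeasureTheory.IntegrableOn.union ?_ ?_
  · have h := (intervalIntegrable_iff_integrableOn_Ioc_of_le zero_le_one).1
      (intervalIntegral.intervalIntegrable_rpow' (a := 0) (b := 1) (r := a - 1) (by linarith))
    refine h.mono' hmeas.aestronglyMeasurable ?_
    refine (MeasureTheory.ae_restrict_mem measurableSet_Ioc).mono fun t ht => ?_
    have ht0 : 0 < t := ht.1
    rw [Real.norm_of_nonneg (by positivity)]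
    exact mul_le_of_le_one_right (by positivity) (min_le_left _ _)
  · have h := integrableOn_Ioi_rpow_of_lt (a := a - 1 - n) (c := 1) (by linarith) one_pos
    refine h.mono' hmeas.aestronglyMeasurable ?_
    refine (MeasureTheory.ae_restrict_mem measurableSet_Ioi).mono fun t ht => ?_
    have ht0 : 0 < t := one_pos.trans ht
    rw [Real.norm_of_nonneg (by positivity), Real.rpow_sub_natCast ht0.ne', div_eq_mul_inv]
    gcongr
    exact min_le_right _ _

/-- Scaling behaviour of the majorant `g t = t ^ (a - 1) * min 1 (t ^ n)⁻¹` of the Balakrishnan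
integrand: the majorant for `T ^ k` is `s ^ (1 - a) * g (s * t)` with `s = k + 1`. -/
theorem rpow_mul_min_comp_mul {s t : ℝ} (hs : 0 < s) (ht : 0 < t) (a : ℝ) (n : ℕ) :
    s ^ (1 - a) * ((s * t) ^ (a - 1) * min 1 ((s * t) ^ n)⁻¹) =
      t ^ (a - 1) * min 1 ((s * t) ^ n)⁻¹ := by
  have h : s ^ (1 - a) * s ^ (a - 1) = 1 := by rw [← Real.rpow_add hs]; simp
  rw [Real.mul_rpow hs.le ht.le, ← mul_assoc, ← mul_assoc, h, one_mul]

theorem integral_rpow_mul_min_comp_mul {a : ℝ} {n : ℕ} {s : ℝ} (hs : 0 < s) :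
    ∫ t in Set.Ioi (0 : ℝ), t ^ (a - 1) * min 1 ((s * t) ^ n)⁻¹ =
      s ^ (-a) * ∫ t in Set.Ioi (0 : ℝ), t ^ (a - 1) * min 1 (t ^ n)⁻¹ := by
  have h := MeasureTheory.integral_comp_mul_left_Ioi
    (fun t : ℝ => t ^ (a - 1) * min 1 (t ^ n)⁻¹) 0 hs
  rw [mul_zero, smul_eq_mul] at h
  have h2 : s ^ (-a) = s ^ (1 - a) * s⁻¹ := by
    rw [← Real.rpow_neg_one s, ← Real.rpow_add hs]; congr 1; ring
  rw [h2, mul_assoc, ← h, ← MeasureTheory.integral_const_mul]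
  exact MeasureTheory.setIntegral_congr_fun measurableSet_Ioi fun t ht =>
    (rpow_mul_min_comp_mul hs ht a n).symm

theorem integrableOn_rpow_mul_min_comp_mul {a : ℝ} {n : ℕ} (ha : 0 < a) (han : a < n) {s : ℝ}
    (hs : 0 < s) :
    MeasureTheory.IntegrableOn (fun t : ℝ => t ^ (a - 1) * min 1 ((s * t) ^ n)⁻¹) (Set.Ioi 0) := by
  have h : MeasureTheory.IntegrableOn
      (fun t : ℝ => s ^ (1 - a) * ((s * t) ^ (a - 1) * min 1 ((s * t) ^ n)⁻¹)) (Set.Ioi 0) :=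
    ((MeasureTheory.integrableOn_Ioi_comp_mul_left_iff
      (fun t : ℝ => t ^ (a - 1) * min 1 (t ^ n)⁻¹) 0 hs).2
      (by simpa using integrableOn_rpow_mul_min ha han)).const_mul _
  exact h.congr_fun (fun t ht => rpow_mul_min_comp_mul hs ht a n) measurableSet_Ioi

section Ritt

variable {X : Type*} [NormedAddCommGroup X] [NormedSpace ℂ X] [CompleteSpace X]

theorem continuousOn_fracPowIntegrand {T : X →L[ℂ] X} {c : ℝ} (hT : ∀ k : ℕ, ‖T ^ k‖ ≤ c) (a : ℝ) :
    ContinuousOn (fracPowIntegrand (1 - T) a) (Set.Ioi 0) := by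
  intro t ht
  have ht0 : (0 : ℝ) < t := ht
  obtain ⟨u, hu⟩ := (isUnit_smul_one_add_one_sub hT ht0).1
  have hR : ContinuousAt
      (fun t : ℝ => Ring.inverse ((t : ℂ) • (1 : X →L[ℂ] X) + (1 - T))) t := by
    refine ContinuousAt.comp (g := Ring.inverse) ?_ (by fun_prop)
    rw [← hu]
    exact NormedRing.inverse_continuousAt u
  have hp : ContinuousAt (fun t : ℝ => ((t ^ (a - 1) : ℝ) : ℂ)) t :=
    Complex.continuous_ofReal.continuousAt.comp (Real.continuousAt_rpow_const _ _ (Or.inl ht0.ne'))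
  exact (hp.smul ((continuousAt_const.mul hR).pow _)).continuousWithinAt

theorem IsRittOperator.exists_norm_fracPowIntegrand_mul_pow_le {T : X →L[ℂ] X}
    (hT : IsRittOperator T) (a : ℝ) :
    ∃ M : ℝ, 0 ≤ M ∧ ∀ (k : ℕ) (t : ℝ), 0 < t → ‖fracPowIntegrand (1 - T) a t * T ^ k‖ ≤
      M * (t ^ (a - 1) * min 1 (((k + 1) * t) ^ (⌊a⌋₊ + 1))⁻¹) := by
  obtain ⟨M, hM0, hM⟩ := hT.exists_norm_resolvent_pow_mul_pow_le (Nat.succ_pos ⌊a⌋₊)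
  refine ⟨M, hM0, fun k t ht => ?_⟩
  rw [fracPowIntegrand, smul_mul_assoc, norm_smul, Complex.norm_of_nonneg (by positivity)]
  calc _ ≤ t ^ (a - 1) * (M * min 1 (((k + 1) * t) ^ (⌊a⌋₊ + 1))⁻¹) := by
        gcongr; exact hM k t ht
    _ = _ := by ring

theorem IsRittOperator.integrableOn_fracPowIntegrand {T : X →L[ℂ] X} (hT : IsRittOperator T) {a : ℝ}
    (ha : 0 < a) : MeasureTheory.IntegrableOn (fracPowIntegrand (1 - T) a) (Set.Ioi (0 : ℝ)) := by
  obtain ⟨M, hM0, hM⟩ := hT.exists_norm_fracPowIntegrand_mul_pow_le a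
  obtain ⟨⟨c, hc, hT₀⟩, -⟩ := hT
  have han : a < (⌊a⌋₊ + 1 : ℕ) := by exact_mod_cast Nat.lt_floor_add_one a
  refine ((integrableOn_rpow_mul_min ha han).const_mul M).mono'
    ((continuousOn_fracPowIntegrand hT₀ a).aestronglyMeasurable measurableSet_Ioi) ?_
  refine (MeasureTheory.ae_restrict_mem measurableSet_Ioi).mono fun t ht => ?_
  simpa using hM 0 t ht

/-- The discrete analogue of `‖A ^ a e ^ {-sA}‖ = O(s ^ {-a})` for analytic semigroups. -/
theorem IsRittOperator.exists_norm_fracPow_mul_pow_le {T : X →L[ℂ] X} (hT : IsRittOperator T)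
    {a : ℝ} (ha : 0 < a) :
    ∃ M : ℝ, 0 ≤ M ∧ ∀ k : ℕ, ‖fracPow (1 - T) a * T ^ k‖ ≤ M * ((k : ℝ) + 1) ^ (-a) := by
  obtain ⟨M, hM0, hM⟩ := hT.exists_norm_fracPowIntegrand_mul_pow_le a
  have han : a < (⌊a⌋₊ + 1 : ℕ) := by exact_mod_cast Nat.lt_floor_add_one a
  set J : ℝ := ∫ t in Set.Ioi (0 : ℝ), t ^ (a - 1) * min 1 (t ^ (⌊a⌋₊ + 1))⁻¹ with hJdef
  have hJ : 0 ≤ J := MeasureTheory.setIntegral_nonneg measurableSet_Ioi fun t ht => by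
    have ht0 : (0 : ℝ) < t := ht
    positivity
  set Γ : ℂ := ((Real.Gamma ((⌊a⌋₊ : ℝ) + 1) /
      (Real.Gamma a * Real.Gamma ((⌊a⌋₊ : ℝ) + 1 - a)) : ℝ) : ℂ) with hΓ
  refine ⟨‖Γ‖ * (M * J), by positivity, fun k => ?_⟩
  have hk : (0 : ℝ) < (k : ℝ) + 1 := by positivity
  rw [fracPow, smul_mul_assoc, norm_smul, ← hΓ,
    ← integral_mul_const_of_integrable (hT.integrableOn_fracPowIntegrand ha), mul_assoc]
  gcongr
  calc _ ≤ ∫ t in Set.Ioi (0 : ℝ),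
        M * (t ^ (a - 1) * min 1 (((k + 1) * t) ^ (⌊a⌋₊ + 1))⁻¹) :=
        MeasureTheory.norm_integral_le_of_norm_le
          ((integrableOn_rpow_mul_min_comp_mul ha han hk).const_mul M)
          ((MeasureTheory.ae_restrict_mem measurableSet_Ioi).mono fun t ht => hM k t ht)
    _ = M * J * ((k : ℝ) + 1) ^ (-a) := by
        rw [MeasureTheory.integral_const_mul, integral_rpow_mul_min_comp_mul hk]
        ring

end Ritt

theorem proposition3p2 {X : Type*} [NormedAddCommGroup X] [NormedSpace ℂ X] [CompleteSpace X]
    (T : X →L[ℂ] X) (hT : IsRittOperator T)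
    (α β : ℝ) (hα : -1 < α) (hβ : -1 < β) (m : ℕ) (hm : (α + β) / 2 = (m : ℝ)) :
    -- the fractional power `(I - T) ^ ((1 + α) / 2)` is well defined
    ((∀ t : ℝ, 0 < t → IsUnit ((t : ℂ) • (1 : X →L[ℂ] X) + (1 - T))) ∧
      MeasureTheory.IntegrableOn (fracPowIntegrand (1 - T) ((1 + α) / 2)) (Set.Ioi (0 : ℝ))) ∧
    -- the resolvents exist and the Weiss condition holds
    ∃ K : ℝ, 0 ≤ K ∧ ∀ ω : ℂ, ‖ω‖ < 1 →
      IsUnit ((1 : X →L[ℂ] X) - ω • T) ∧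
      (1 - ‖ω‖ ^ 2) ^ ((1 + β) / 2) *
        ‖fracPow (1 - T) ((1 + α) / 2) * (Ring.inverse (1 - ω • T)) ^ (m + 1)‖ ≤ K := by
  have ha : 0 < (1 + α) / 2 := by linarith
  have hb : 0 < (1 + β) / 2 := by linarith
  -- with `a = (1 + α) / 2` and `b = (1 + β) / 2`, the hypothesis on `m` says `a + b = m + 1`
  have hab : (1 + β) / 2 - 1 = m + -((1 + α) / 2) := by rw [← hm]; ring
  obtain ⟨c, hc, hT₀⟩ := hT.1
  obtain ⟨M, hM0, hM⟩ := hT.exists_norm_fracPow_mul_pow_le ha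
  obtain ⟨C, hC0, hC⟩ := exists_tsum_rpow_mul_pow_le hb
  refine ⟨⟨fun t ht => (isUnit_smul_one_add_one_sub hT₀ ht).1,
    hT.integrableOn_fracPowIntegrand ha⟩,
    2 ^ ((1 + β) / 2) * (M * C), by positivity, fun ω hω => ?_⟩
  set a := (1 + α) / 2
  set b := (1 + β) / 2
  obtain ⟨hu, hS⟩ := hasSum_choose_nsmul_pow (norm_nonneg ω) hω (norm_smul_pow_le hT₀ ω)
  obtain ⟨hs, hle⟩ := hC ‖ω‖ (norm_nonneg ω) hω
  refine ⟨hu, ?_⟩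
  have hterm : ∀ k : ℕ, ‖fracPow (1 - T) a * ((k + m).choose m • (ω • T) ^ k)‖ ≤
      M * (((k : ℝ) + 1) ^ (b - 1) * ‖ω‖ ^ k) := fun k => by
    have hk : (0 : ℝ) < (k : ℝ) + 1 := by positivity
    have hch : ((k + m).choose m : ℝ) ≤ ((k : ℝ) + 1) ^ m := by
      exact_mod_cast Nat.choose_add_le_add_one_pow k m
    rw [mul_smul_comm, smul_pow, mul_smul_comm]
    calc _ ≤ ((k + m).choose m : ℝ) * (‖ω‖ ^ k * ‖fracPow (1 - T) a * T ^ k‖) := by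
          refine norm_nsmul_le.trans ?_
          rw [norm_smul, norm_pow]
      _ ≤ ((k : ℝ) + 1) ^ m * (‖ω‖ ^ k * (M * ((k : ℝ) + 1) ^ (-a))) := by
          gcongr; exact hM k
      _ = M * (((k : ℝ) + 1) ^ (b - 1) * ‖ω‖ ^ k) := by
          rw [hab, Real.rpow_add hk, Real.rpow_natCast]; ring
  have hnorm : ‖fracPow (1 - T) a * Ring.inverse (1 - ω • T) ^ (m + 1)‖ ≤
      M * ∑' k : ℕ, ((k : ℝ) + 1) ^ (b - 1) * ‖ω‖ ^ k := by
    rw [← ((hS m).mul_left (fracPow (1 - T) a)).tsum_eq]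
    exact tsum_of_norm_bounded (hs.hasSum.mul_left M) hterm
  have hω0 := norm_nonneg ω
  have hδ : 0 ≤ 1 - ‖ω‖ := by linarith
  have hw : (1 - ‖ω‖ ^ 2) ^ b ≤ 2 ^ b * (1 - ‖ω‖) ^ b := by
    rw [← Real.mul_rpow zero_le_two hδ]
    exact Real.rpow_le_rpow (by nlinarith) (by nlinarith) hb.le
  calc _ ≤ (2 ^ b * (1 - ‖ω‖) ^ b) * (M * ∑' k : ℕ, ((k : ℝ) + 1) ^ (b - 1) * ‖ω‖ ^ k) := by
        gcongr
    _ = 2 ^ b * (M * ((1 - ‖ω‖) ^ b * ∑' k : ℕ, ((k : ℝ) + 1) ^ (b - 1) * ‖ω‖ ^ k)) := by ring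
    _ ≤ 2 ^ b * (M * C) := by gcongr
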